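/- All graphs are finite, simple and nonempty. A block graph is a graph in which every block (maximal connected subgraph without a cut vertex of its own) is complete. A graph is called well-covered here if each of its vertices lies in an independent set of maximum size, i.e. $\alpha_{\min}(G)=\alpha(G)$, where $\alpha_{\min}(G)=\min_{v\in V(G)}\alpha(G,v)$ and $\alpha(G,v)$ is the largest size of an independent set containing $v$. Let $\omega(G)$ be the largest size of a clique of $G$. Given a graph $H$, a vertex $v$ of $H$, an integer $s\ge 2$ and integers $q_1,\dots,q_{s-1}\ge 2$, consider the following operation: add to $H$ a clique $Q$ of size $s$ with $V(Q)=\{v,v_1,\dots,v_{s-1}\}$ and $Q\cap H=\{v\}$, and then, for each $i\in\{1,\dots,s-1\}$, add a clique $Q_i$ of size $q_i$ that contains $v_i$ and whose other $q_i-1$ vertices are new (so $Q_i$ is a pendant clique attached at $v_i$). **Theorem.** Let $G$ be a graph. Then $G$ is a connected well-covered block graph if and only if one of the following holds: 1. $G$ is a complete graph (of size at most $\omega(G)$); 2. $G$ is isomorphic to a graph obtained by the operation above from a connected well-covered block graph $H$ with $2\le |V(H)|<|V(G)|$ and $\omega(H)\le\omega(G)$, for some $v\in V(H)$, $s\geq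 2$ and $q_1,\dots,q_{s-1}\geq 2$, where all the cliques involved have size at most $\omega(G)$, i.e. $s\le\omega(G)$ and $q_i\le\omega(G)$ for all $i$. -/

import Mathlib

universe u

namespace SimpleGraph

variable {V : Type u}

/-- A set `S` of vertices is nonseparable if the subgraph induced by `S` is connected (in particular
`S` is nonempty) and has no cut vertex: deleting any one vertex never disconnects it. Single
vertices and edges count as nonseparable. -/
def IsNonseparable (G : SimpleGraph V) (S : Set V) : Prop :=
  (G.induce S).Connected ∧ ∀ v ∈ S, (G.induce (S \ {v})).Preconnected

/-- The vertex set of a block (2-connected component): an inclusion-maximal nonseparable set. -/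
def IsBlock (G : SimpleGraph V) (S : Set V) : Prop :=
  Maximal G.IsNonseparable S

/-- A block graph: every block is complete. -/
def IsBlockGraph (G : SimpleGraph V) : Prop :=
  ∀ S : Set V, G.IsBlock S → G.IsClique S

/-- Every vertex lies in an independent set of maximum size, i.e. `α_min(G) = α(G)`. -/
def IsWellCovered [Finite V] (G : SimpleGraph V) : Prop :=
  ∀ v : V, ∃ I : Finset V, G.IsMaximumIndepSet I ∧ v ∈ I

/-- The adjacency relation of `attachClique`. -/
def AttachAdj (H : SimpleGraph V) (v : V) (s : ℕ) (q : Fin (s - 1) → ℕ) :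
    V ⊕ (Σ i : Fin (s - 1), Fin (q i)) → V ⊕ (Σ i : Fin (s - 1), Fin (q i)) → Prop
  | .inl a, .inl b => H.Adj a b
  | .inl a, .inr y => a = v ∧ y.2.val = 0
  | .inr x, .inl b => b = v ∧ x.2.val = 0
  | .inr x, .inr y =>
      (x.1 = y.1 ∧ x.2.val ≠ y.2.val) ∨ (x.1 ≠ y.1 ∧ x.2.val = 0 ∧ y.2.val = 0)

/-- The graph obtained from `H` by gluing a clique `Q` of size `s` to `H` at the vertex `v` and a
new clique `Q i` of size `q i` to each of the `s - 1` other vertices of `Q`.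
The new vertices are the pairs `⟨i, j⟩` with `j < q i`. Those with a fixed `i` form the clique
`Q i`, and the clique `Q` consists of `v` and the vertices `⟨i, 0⟩`. -/
def attachClique (H : SimpleGraph V) (v : V) (s : ℕ) (q : Fin (s - 1) → ℕ) :
    SimpleGraph (V ⊕ (Σ i : Fin (s - 1), Fin (q i))) where
  Adj := H.AttachAdj v s q
  symm := ⟨by
    rintro (a | x) (b | y) h
    · exact H.adj_symm h
    · exact h
    · exact h
    · rcases h with ⟨h1, h2⟩ | ⟨h1, h2, h3⟩
      · exact Or.inl ⟨h1.symm, h2.symm⟩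
      · exact Or.inr ⟨h1.symm, h3, h2⟩⟩
  loopless := ⟨by
    rintro (a | x) h
    · exact H.irrefl h
    · rcases h with ⟨_, h⟩ | ⟨h, _⟩ <;> exact h rfl⟩

end SimpleGraph

namespace SimpleGraph

/-! ### Cycles in block graphs -/

section Structure

variable {V : Type u} {G : SimpleGraph V}

/-! Block graphs enter through one principle (`IsBlockGraph.adj_of_walk`): two neighbours of `c`
joined by a walk avoiding `c` lie with `c` on a cycle, hence are adjacent. In the distance layers
from a root `r` it gives each vertex a unique parent, and makes the vertices of a layer fall into
cliques of siblings.

Well-coveredness enters through an exchange (`IsWellCovered.adj_of_dominated`): replacing `w` in a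
maximum independent set by two nonadjacent neighbours whose neighbourhoods `w` dominates would
enlarge it.

If `G` is not complete, let `x₀` be a deepest vertex, `w₀` its parent, `v` its grandparent, and `C`
the sibling clique of `w₀`. The exchange shows that the children of each `w ∈ C` form a nonempty
clique and that something besides `v` survives the removal of `C` and its children. What survives is
the base graph.

For the extended graph, an independent set has at most one vertex in each pendant clique, and a
maximum independent set of `H` extends by non-attaching vertices. So the independence number grows
by exactly `s - 1`, and well-coveredness passes both ways. -/

theorem preconnected_induce_iff_exists_walk {T : Set V} :
    (G.induce T).Preconnected ↔
      ∀ a ∈ T, ∀ b ∈ T, ∃ p : G.Walk a b, ∀ x ∈ p.support, x ∈ T := by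
  constructor
  · intro h a ha b hb
    obtain ⟨p⟩ := h ⟨a, ha⟩ ⟨b, hb⟩
    refine ⟨p.map (Embedding.induce T).toHom, fun x hx => ?_⟩
    have : x ∈ (p.map (Embedding.induce T).toHom).support := hx
    rw [Walk.support_map, List.mem_map] at this
    obtain ⟨y, -, rfl⟩ := this
    exact y.2
  · rintro h ⟨a, ha⟩ ⟨b, hb⟩
    obtain ⟨p, hp⟩ := h a ha b hb
    exact ⟨p.induce T hp⟩

/-- To see that an induced subgraph is connected it suffices to reach one fixed vertex. -/
theorem preconnected_induce_of_forall_walk {T : Set V} (c : V)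
    (h : ∀ a ∈ T, ∃ p : G.Walk a c, ∀ x ∈ p.support, x ∈ T) :
    (G.induce T).Preconnected := by
  rw [preconnected_induce_iff_exists_walk]
  intro a ha b hb
  obtain ⟨p, hp⟩ := h a ha
  obtain ⟨q, hq⟩ := h b hb
  refine ⟨p.append q.reverse, fun x hx => ?_⟩
  rw [Walk.mem_support_append_iff, Walk.support_reverse, List.mem_reverse] at hx
  exact hx.elim (hp x) (hq x)

theorem isNonseparable_image_iff {W : Type*} {H : SimpleGraph W} (f : H ↪g G) (T : Set W) :
    G.IsNonseparable (f '' T) ↔ H.IsNonseparable T := by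
  have e : ∀ S : Set W, H.induce S ≃g G.induce (f '' S) := fun S =>
    { toEquiv := Equiv.Set.image f S f.injective
      map_rel_iff' := by simp }
  unfold IsNonseparable
  rw [(e T).connected_iff, Set.forall_mem_image]
  refine and_congr_right fun _ => forall₂_congr fun v _ => ?_
  rw [(e _).preconnected_iff, Set.image_sdiff f.injective, Set.image_singleton]

theorem isBlockGraph_iff [Finite V] :
    G.IsBlockGraph ↔ ∀ S : Set V, G.IsNonseparable S → G.IsClique S := by
  refine ⟨fun h S hS => ?_, fun h S hS => h S hS.prop⟩
  obtain ⟨T, hST, hT⟩ := Finite.exists_le_maximal hS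
  exact (h T hT).subset hST

theorem IsBlockGraph.of_embedding {W : Type*} [Finite V] [Finite W] {H : SimpleGraph W}
    (f : H ↪g G) (h : G.IsBlockGraph) : H.IsBlockGraph := by
  rw [isBlockGraph_iff] at h ⊢
  intro S hS a ha b hb hab
  exact f.map_adj_iff.1 (h _ ((isNonseparable_image_iff f S).2 hS) (Set.mem_image_of_mem f ha)
    (Set.mem_image_of_mem f hb) (f.injective.ne hab))

/-- If no edge leaves `A` except to `c`, a nonseparable set lies on one side of `c`. -/
theorem IsNonseparable.subset_or_disjoint {S A : Set V} {c : V} (hS : G.IsNonseparable S)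
    (hcA : c ∉ A) (hA : ∀ x ∈ A, ∀ y, G.Adj x y → y ∈ A ∨ y = c) :
    S ⊆ insert c A ∨ Disjoint S A := by
  by_contra! hcon
  obtain ⟨h1, h2⟩ := hcon
  obtain ⟨y, hyS, hy⟩ := Set.not_subset.1 h1
  obtain ⟨x, hxS, hxA⟩ := Set.not_disjoint_iff.1 h2
  simp only [Set.mem_insert_iff, not_or] at hy
  have hpre : (G.induce (S \ {c})).Preconnected := by
    by_cases hc : c ∈ S
    · exact hS.2 c hc
    · rw [Set.sdiff_singleton_eq_self hc]
      exact hS.1.preconnected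
  obtain ⟨p, hp⟩ := preconnected_induce_iff_exists_walk.1 hpre x ⟨hxS, fun h => hcA (h ▸ hxA)⟩ y
    ⟨hyS, hy.1⟩
  -- A walk avoiding `c` has no way out of `A`.
  have key : ∀ {a b : V} (p : G.Walk a b), (∀ z ∈ p.support, z ≠ c) → a ∈ A → b ∈ A := by
    intro a b p
    induction p with
    | nil => exact fun _ h => h
    | cons hadj q ih =>
      intro hz ha
      refine ih (fun z hzq => hz z (by simp [hzq])) ?_
      exact (hA _ ha _ hadj).resolve_right (hz _ (by simp))
  exact hy.2 (key p (fun z hz => (hp z hz).2) hxA)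

/-- The path closes up through `c` to a cycle. After deleting `v ≠ c`, a vertex of the path still
reaches `c` via `a` or via `b`: a path has no repeated vertex, so `v` blocks only one of the two
arcs. -/
theorem isNonseparable_insert_support [DecidableEq V] {a b c : V} (ha : G.Adj c a)
    (hb : G.Adj c b) (p : G.Walk a b) (hp : p.IsPath) (hc : c ∉ p.support) :
    G.IsNonseparable (insert c {x | x ∈ p.support}) := by
  have toA : ∀ u (hu : u ∈ p.support), ∀ v, v ≠ c → v ∉ (p.takeUntil u hu).support →
      ∃ q : G.Walk u c, ∀ x ∈ q.support, x ∈ insert c {x | x ∈ p.support} ∧ x ≠ v := by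
    intro u hu v hvc hv
    refine ⟨(Walk.cons ha (p.takeUntil u hu)).reverse, fun x hx => ?_⟩
    simp only [Walk.support_reverse, Walk.support_cons, List.mem_reverse, List.mem_cons] at hx
    rcases hx with rfl | hx
    · exact ⟨Set.mem_insert _ _, hvc.symm⟩
    · exact ⟨Or.inr (p.support_takeUntil_subset_support hu hx), fun h => hv (h ▸ hx)⟩
  have toB : ∀ u (hu : u ∈ p.support), ∀ v, v ≠ c → v ∉ (p.dropUntil u hu).support →
      ∃ q : G.Walk u c, ∀ x ∈ q.support, x ∈ insert c {x | x ∈ p.support} ∧ x ≠ v := by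
    intro u hu v hvc hv
    refine ⟨(Walk.cons hb (p.dropUntil u hu).reverse).reverse, fun x hx => ?_⟩
    simp only [Walk.support_reverse, Walk.support_cons, List.mem_reverse, List.mem_cons] at hx
    rcases hx with rfl | hx
    · exact ⟨Set.mem_insert _ _, hvc.symm⟩
    · exact ⟨Or.inr (p.support_dropUntil_subset_support hu hx), fun h => hv (h ▸ hx)⟩
  have del : ∀ v, v ≠ c → (G.induce (insert c {x | x ∈ p.support} \ {v})).Preconnected := by
    intro v hvc
    refine preconnected_induce_of_forall_walk c ?_
    rintro u ⟨rfl | hu, huv⟩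
    · exact ⟨Walk.nil, by simpa using Ne.symm hvc⟩
    · by_cases hv : v ∈ (p.takeUntil u hu).support
      · refine toB u hu v hvc fun hv' => huv ?_
        have hnd := hp.support_nodup
        rw [← p.take_spec hu, Walk.support_append] at hnd
        rw [Walk.mem_support_iff] at hv'
        rcases hv' with h | h
        · exact h.symm
        · exact absurd h ((List.disjoint_of_nodup_append hnd) hv)
      · exact toA u hu v hvc hv
  refine ⟨(connected_iff _).2 ⟨?_, ⟨c, Set.mem_insert _ _⟩⟩, ?_⟩
  · refine preconnected_induce_of_forall_walk c ?_
    rintro u (rfl | hu)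
    · exact ⟨Walk.nil, by simp⟩
    · refine ⟨(Walk.cons ha (p.takeUntil u hu)).reverse, fun x hx => ?_⟩
      simp only [Walk.support_reverse, Walk.support_cons, List.mem_reverse, List.mem_cons] at hx
      exact hx.imp id fun hx => p.support_takeUntil_subset_support hu hx
  · intro v hv
    by_cases hvc : v = c
    · subst hvc
      rw [Set.insert_sdiff_self_of_notMem (by simpa using hc), preconnected_induce_iff_exists_walk]
      have : ∀ u ∈ p.support, ∃ q : G.Walk u a, ∀ x ∈ q.support, x ∈ p.support := fun u hu =>
        ⟨(p.takeUntil u hu).reverse, fun x hx =>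
          p.support_takeUntil_subset_support hu (by simpa using hx)⟩
      exact preconnected_induce_iff_exists_walk.1 (preconnected_induce_of_forall_walk a this)
    · exact del v hvc

theorem IsBlockGraph.adj_of_walk [Finite V] (hG : G.IsBlockGraph) {a b c : V} (ha : G.Adj c a)
    (hb : G.Adj c b) (hab : a ≠ b) (p : G.Walk a b) (hc : c ∉ p.support) : G.Adj a b := by
  classical
  have hS := isNonseparable_insert_support ha hb p.bypass p.bypass_isPath
    fun h => hc (p.support_bypass_subset_support h)
  exact isBlockGraph_iff.1 hG _ hS (Or.inr p.bypass.start_mem_support)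
    (Or.inr p.bypass.end_mem_support) hab

/-! ### Distance layers of a block graph, and the exchange argument -/

theorem Connected.exists_adj_dist_eq (hG : G.Connected) {r x : V} {k : ℕ}
    (hx : G.dist r x = k + 1) : ∃ y, G.Adj x y ∧ G.dist r y = k := by
  obtain ⟨p, hp⟩ := hG.exists_walk_length_eq_dist x r
  rw [dist_comm, hx] at hp
  cases p with
  | nil => simp at hp
  | @cons _ y _ h q =>
    refine ⟨y, h, le_antisymm ?_ ?_⟩
    · rw [dist_comm]
      have := dist_le q
      simp at hp
      omega
    · have := hG.dist_triangle (u := r) (v := y) (w := x)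
      rw [dist_eq_one_iff_adj.2 h.symm] at this
      omega

/-- Follow parents down to `r`. Staying in the ball of radius `k` certifies later that the walk
avoids a given deeper vertex. -/
theorem Connected.exists_walk_dist_le (hG : G.Connected) (r : V) (k : ℕ) :
    ∀ x, G.dist r x ≤ k → ∃ p : G.Walk x r, ∀ z ∈ p.support, G.dist r z ≤ k := by
  induction k with
  | zero =>
    intro x hx
    obtain rfl : r = x := hG.dist_eq_zero_iff.1 (by omega)
    exact ⟨Walk.nil, by simp⟩
  | succ k ih =>
    intro x hx
    rcases Nat.lt_or_ge k (G.dist r x) with h | h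
    · obtain ⟨y, hxy, hy⟩ := hG.exists_adj_dist_eq (le_antisymm hx h)
      obtain ⟨p, hp⟩ := ih y hy.le
      refine ⟨Walk.cons hxy p, fun z hz => ?_⟩
      rw [Walk.support_cons, List.mem_cons] at hz
      rcases hz with rfl | hz
      · exact hx
      · exact (hp z hz).trans k.le_succ
    · obtain ⟨p, hp⟩ := ih x h
      exact ⟨p, fun z hz => (hp z hz).trans k.le_succ⟩

theorem Connected.exists_walk_dist_le₂ (hG : G.Connected) (r : V) (k : ℕ) {x y : V}
    (hx : G.dist r x ≤ k) (hy : G.dist r y ≤ k) :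
    ∃ p : G.Walk x y, ∀ z ∈ p.support, G.dist r z ≤ k := by
  obtain ⟨p, hp⟩ := hG.exists_walk_dist_le r k x hx
  obtain ⟨q, hq⟩ := hG.exists_walk_dist_le r k y hy
  refine ⟨p.append q.reverse, fun z hz => ?_⟩
  rw [Walk.mem_support_append_iff, Walk.support_reverse, List.mem_reverse] at hz
  exact hz.elim (hp z) (hq z)

variable [Finite V]

/-- From `y` step to a parent of `y`, then go to `p` inside the ball of radius `k`; this joins two
neighbours of `x` while avoiding `x`. -/
theorem IsBlockGraph.adj_of_adj_parent (hB : G.IsBlockGraph) (hG : G.Connected) {r : V} {k : ℕ}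
    {x y p : V} (hx : G.dist r x = k + 1) (hy : G.dist r y = k + 1) (hxy : G.Adj x y)
    (hxp : G.Adj x p) (hp : G.dist r p = k) : G.Adj y p := by
  obtain ⟨p', hyp', hp'⟩ := hG.exists_adj_dist_eq hy
  obtain ⟨q, hq⟩ := hG.exists_walk_dist_le₂ r k hp'.le hp.le
  refine hB.adj_of_walk hxy hxp ?_ (Walk.cons hyp' q) ?_
  · rintro rfl
    omega
  · rw [Walk.support_cons, List.mem_cons, not_or]
    exact ⟨hxy.ne, fun h => by have := hq _ h; omega⟩

/-- Two parents `y`, `z` of `x` would be adjacent, so they would share a parent `p`. The path `x`,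
`z`, `p` avoids `y`, so `x` would be adjacent to `p`, two layers below it. -/
theorem IsBlockGraph.parent_unique (hB : G.IsBlockGraph) (hG : G.Connected) {r : V} {k : ℕ} :
    ∀ {x y z : V}, G.dist r x = k + 1 → G.dist r y = k → G.dist r z = k →
      G.Adj x y → G.Adj x z → y = z := by
  induction k with
  | zero =>
    intro x y z _ hy hz _ _
    rw [← hG.dist_eq_zero_iff.1 hy, ← hG.dist_eq_zero_iff.1 hz]
  | succ k ih =>
    intro x y z hx hy hz hxy hxz
    by_contra hyz
    obtain ⟨q, hq⟩ := hG.exists_walk_dist_le₂ r (k + 1) hy.le hz.le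
    have hadj : G.Adj y z := hB.adj_of_walk hxy hxz hyz q fun h => by have := hq _ h; omega
    obtain ⟨p, hyp, hp⟩ := hG.exists_adj_dist_eq hy
    have hzp : G.Adj z p := hB.adj_of_adj_parent hG hy hz hadj hyp hp
    have hxp : G.Adj x p := by
      refine hB.adj_of_walk hxy.symm hyp ?_ (Walk.cons hxz (Walk.cons hzp Walk.nil)) ?_
      · rintro rfl
        omega
      · simp [hxy.ne', hyz, hyp.ne]
    have := hG.dist_triangle (u := r) (v := p) (w := x)
    rw [dist_eq_one_iff_adj.2 hxp.symm] at this
    omega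

theorem IsBlockGraph.adj_trans_of_dist_eq (hB : G.IsBlockGraph) (hG : G.Connected) {r x y z : V}
    (hx : G.dist r x = G.dist r y) (hz : G.dist r z = G.dist r y) (hxy : G.Adj x y)
    (hyz : G.Adj y z) (hxz : x ≠ z) : G.Adj x z := by
  obtain ⟨k, hk⟩ : ∃ k, G.dist r y = k + 1 := by
    refine Nat.exists_eq_succ_of_ne_zero fun h => hxy.ne ?_
    rw [← hG.dist_eq_zero_iff.1 h, ← hG.dist_eq_zero_iff.1 (hx.trans h)]
  obtain ⟨p, hyp, hp⟩ := hG.exists_adj_dist_eq hk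
  have hxp := hB.adj_of_adj_parent hG hk (hx.trans hk) hxy.symm hyp hp
  have hzp := hB.adj_of_adj_parent hG hk (hz.trans hk) hyz hyp hp
  refine hB.adj_of_walk hxy.symm hyz hxz (Walk.cons hxp (Walk.cons hzp.symm Walk.nil)) ?_
  simp [hxy.ne', hyz.ne, hyp.ne]

/-- In a graph all of whose vertices lie in maximum independent sets, the neighbourhood of a
vertex cannot dominate those of two nonadjacent neighbours. -/
theorem IsWellCovered.adj_of_dominated (hW : G.IsWellCovered) {w x y : V} (hwx : G.Adj w x)
    (hwy : G.Adj w y) (hxy : x ≠ y) (hx : ∀ z, G.Adj x z → z = w ∨ G.Adj w z)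
    (hy : ∀ z, G.Adj y z → z = w ∨ G.Adj w z) : G.Adj x y := by
  classical
  by_contra hn
  obtain ⟨I, hI, hwI⟩ := hW w
  have hind := hI.isIndepSet
  have hwn : ∀ z ∈ I, ¬ G.Adj w z := fun z hz h => hind hwI hz h.ne h
  have key : ∀ u, (∀ z, G.Adj u z → z = w ∨ G.Adj w z) → ∀ z ∈ I.erase w, ¬ G.Adj u z := by
    intro u hu z hz h
    rw [Finset.mem_erase] at hz
    exact (hu z h).elim hz.1 (hwn z hz.2)
  have hxI : x ∉ I := fun h => hwn x h hwx
  have hyI : y ∉ I := fun h => hwn y h hwy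
  have hJ : G.IsIndepSet (insert x (insert y (I.erase w)) : Finset V) := by
    intro a ha b hb hab h
    simp only [Finset.coe_insert, Set.mem_insert_iff, Finset.mem_coe] at ha hb
    rcases ha with rfl | rfl | ha <;> rcases hb with rfl | rfl | hb
    · exact hab rfl
    · exact hn h
    · exact key _ hx _ hb h
    · exact hn h.symm
    · exact hab rfl
    · exact key _ hy _ hb h
    · exact key _ hx _ ha h.symm
    · exact key _ hy _ ha h.symm
    · exact hind (Finset.mem_of_mem_erase ha) (Finset.mem_of_mem_erase hb) hab h
  have := hI.maximum _ hJ
  rw [Finset.card_insert_of_notMem (by simp [hxy, hxI]),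
    Finset.card_insert_of_notMem (by simp [hyI]), Finset.card_erase_of_mem hwI] at this
  have := Finset.card_pos.2 ⟨w, hwI⟩
  omega

end Structure

/-! ### Splitting off the deepest cliques -/

section Decompose

variable {V : Type u} {G : SimpleGraph V}

/-- Index `0` is reserved for the attaching vertex, as in `attachClique`. -/
theorem exists_fin_enum_insert [Finite V] {a : V} {A : Set V} (ha : a ∉ A) :
    ∃ f : Fin (A.ncard + 1) → V, f.Injective ∧ Set.range f = insert a A ∧ f 0 = a := by
  let e : Fin A.ncard ≃ A := (Finite.equivFinOfCardEq (Nat.card_coe_set_eq A)).symm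
  have hr : Set.range (fun i => (e i : V)) = A := by
    rw [← Function.comp_def, Set.range_comp, e.surjective.range_eq, Set.image_univ,
      Subtype.range_coe]
  refine ⟨Fin.cons a fun i => (e i : V), ?_, ?_, rfl⟩
  · rw [Fin.cons_injective_iff, hr]
    exact ⟨ha, Subtype.val_injective.comp e.injective⟩
  · rw [Fin.range_cons, hr]

/-- If `C` together with `v` is a clique, every `w ∈ C` carries a pendant clique `insert w (L w)`,
and there are no further edges at these vertices, then the graph arises by `attachClique`. -/
theorem exists_iso_attachClique [Finite V] {v : V} {C : Set V} {L : V → Set V}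
    (hvC : v ∉ C) (hvL : ∀ w ∈ C, v ∉ L w) (hC : G.IsClique (insert v C))
    (hL : ∀ w ∈ C, G.IsClique (insert w (L w)))
    (hLC : ∀ w ∈ C, ∀ w' ∈ C, w ∉ L w')
    (hLL : ∀ w ∈ C, ∀ w' ∈ C, w ≠ w' → Disjoint (L w) (L w'))
    (hnL : ∀ w ∈ C, ∀ x ∈ L w, ∀ y, G.Adj x y → y ∈ insert w (L w))
    (hnC : ∀ w ∈ C, ∀ y, G.Adj w y → y = v ∨ y ∈ C ∨ y ∈ L w) :
    ∃ q : Fin (C.ncard + 1 - 1) → ℕ, (∀ i, ∃ w ∈ C, q i = (L w).ncard + 1) ∧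
      Nonempty (G ≃g (G.induce {x | ∀ w ∈ C, x ∉ insert w (L w)}).attachClique
        ⟨v, fun w hw h => h.elim (fun h => hvC (h ▸ hw)) (hvL w hw)⟩ (C.ncard + 1) q) := by
  let e : Fin (C.ncard + 1 - 1) ≃ C := (Finite.equivFinOfCardEq (Nat.card_coe_set_eq C)).symm
  have hex := fun i => exists_fin_enum_insert (hLC _ (e i).2 _ (e i).2)
  choose f finj frange f0 using hex
  have fmem : ∀ i j, f i j ∈ insert (e i : V) (L (e i)) := fun i j => by
    rw [← frange i]
    exact Set.mem_range_self j
  have fzero : ∀ i j, j.val = 0 → f i j = e i := fun i j hj => by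
    rw [show j = 0 from Fin.ext hj, f0]
  have fL : ∀ i j, j.val ≠ 0 → f i j ∈ L (e i) := fun i j hj =>
    (fmem i j).resolve_left fun h => hj (congrArg Fin.val (finj i (h.trans (f0 i).symm)))
  have hdisj : ∀ i i' x, x ∈ insert (e i : V) (L (e i)) → x ∈ insert (e i' : V) (L (e i')) →
      i = i' := by
    rintro i i' x (rfl | h) (h' | h')
    · exact e.injective (Subtype.ext h')
    · exact absurd h' (hLC _ (e i).2 _ (e i').2)
    · exact absurd (h' ▸ h) (hLC _ (e i').2 _ (e i).2)
    · by_contra hne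
      exact Set.disjoint_left.1
        (hLL _ (e i).2 _ (e i').2 fun h => hne (e.injective (Subtype.ext h))) h h'
  refine ⟨fun i => (L (e i)).ncard + 1, fun i => ⟨e i, (e i).2, rfl⟩, ⟨Iso.symm ?_⟩⟩
  refine ⟨Equiv.ofBijective (Sum.elim Subtype.val fun x => f x.1 x.2) ⟨?_, ?_⟩, ?_⟩
  · refine Function.Injective.sumElim Subtype.val_injective ?_ ?_
    · rintro ⟨i, j⟩ ⟨i', j'⟩ h
      obtain rfl : i = i' := hdisj i i' _ (fmem i j) (by
        have h : f i j = f i' j' := h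
        rw [h]
        exact fmem i' j')
      exact congrArg _ (finj i h)
    · rintro ⟨a, ha⟩ ⟨i, j⟩ rfl
      exact ha _ (e i).2 (fmem i j)
  · intro x
    by_cases hx : ∀ w ∈ C, x ∉ insert w (L w)
    · exact ⟨.inl ⟨x, hx⟩, rfl⟩
    · push Not at hx
      obtain ⟨w, hw, hx⟩ := hx
      obtain ⟨i, hi⟩ := e.surjective ⟨w, hw⟩
      have hx' : x ∈ Set.range (f i) := by rwa [frange, hi]
      obtain ⟨j, rfl⟩ := hx'
      exact ⟨.inr ⟨i, j⟩, rfl⟩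
  · have mixed : ∀ (a : V) (_ : ∀ w ∈ C, a ∉ insert w (L w)) i j,
        G.Adj a (f i j) ↔ a = v ∧ j.val = 0 := by
      intro a ha i j
      by_cases hj : j.val = 0
      · simp only [fzero i j hj, hj, and_true]
        constructor
        · intro h
          rcases hnC _ (e i).2 _ h.symm with h | h | h
          · exact h
          · exact absurd (Set.mem_insert _ _) (ha a h)
          · exact absurd (Set.mem_insert_of_mem _ h) (ha _ (e i).2)
        · rintro rfl
          exact hC (Set.mem_insert _ _) (Set.mem_insert_of_mem _ (e i).2)
            fun h => hvC (h ▸ (e i).2)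
      · simp only [hj, and_false, iff_false]
        exact fun h => ha _ (e i).2 (hnL _ (e i).2 _ (fL i j hj) _ h.symm)
    rintro (⟨a, ha⟩ | ⟨i, j⟩) (⟨b, hb⟩ | ⟨i', j'⟩)
    · exact Iff.rfl
    · change G.Adj a (f i' j') ↔ (⟨a, ha⟩ : {x | _}) = _ ∧ j'.val = 0
      rw [mixed a ha, Subtype.ext_iff]
    · change G.Adj (f i j) b ↔ (⟨b, hb⟩ : {x | _}) = _ ∧ j.val = 0
      rw [adj_comm, mixed b hb, Subtype.ext_iff]
    · change G.Adj (f i j) (f i' j') ↔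
        (i = i' ∧ j.val ≠ j'.val) ∨ (i ≠ i' ∧ j.val = 0 ∧ j'.val = 0)
      by_cases hi : i = i'
      · subst hi
        simp only [true_and, ne_eq, not_true, false_and, or_false]
        refine ⟨fun h hj => h.ne (by rw [Fin.ext hj]), fun h => ?_⟩
        exact hL _ (e i).2 (fmem i j) (fmem i j') fun h' => h (by rw [finj i h'])
      · simp only [hi, false_and, ne_eq, not_false_eq_true, true_and, false_or]
        constructor
        · intro h
          refine ⟨?_, ?_⟩ <;> by_contra hj
          · exact hi (hdisj i i' _ (hnL _ (e i).2 _ (fL i j hj) _ h) (fmem i' j'))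
          · exact hi (hdisj i i' _ (fmem i j) (hnL _ (e i').2 _ (fL i' j' hj) _ h.symm))
        · rintro ⟨hj, hj'⟩
          rw [fzero i j hj, fzero i' j' hj']
          exact hC (Set.mem_insert_of_mem _ (e i).2) (Set.mem_insert_of_mem _ (e i').2)
            fun h => hi (e.injective (Subtype.ext h))

theorem IsClique.ncard_le_cliqueNum [Finite V] {S : Set V} (hS : G.IsClique S) :
    S.ncard ≤ G.cliqueNum := by
  rw [Set.ncard_eq_toFinset_card S]
  exact IsClique.card_le_cliqueNum (tc := by simpa using hS)

theorem Connected.dist_le_dist_add_one (hG : G.Connected) {r x y : V} (h : G.Adj x y) :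
    G.dist r y ≤ G.dist r x + 1 := by
  have := hG.dist_triangle (u := r) (v := x) (w := y)
  rwa [dist_eq_one_iff_adj.2 h] at this

/-- A connected well-covered block graph that is not complete arises by `attachClique` from one of
its proper induced subgraphs on at least two vertices. -/
theorem exists_attachClique_of_ne_top [Finite V] (hG : G.Connected) (hB : G.IsBlockGraph)
    (hW : G.IsWellCovered) (hne : G ≠ ⊤) :
    ∃ (R : Set V) (v : R) (s : ℕ) (q : Fin (s - 1) → ℕ), Nontrivial R ∧ 2 ≤ s ∧
      s ≤ G.cliqueNum ∧ (∀ i, 2 ≤ q i ∧ q i ≤ G.cliqueNum) ∧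
      Nonempty (G ≃g (G.induce R).attachClique v s q) := by
  classical
  obtain ⟨r⟩ := hG.nonempty
  have := hG.nonempty
  obtain ⟨x₀, hx₀⟩ := Finite.exists_max (G.dist r)
  -- Otherwise `r` is adjacent to every other vertex, and the exchange at `r` makes `G` complete.
  obtain ⟨k, hk⟩ : ∃ k, G.dist r x₀ = k + 2 := by
    by_contra! hcon
    have h1 : ∀ x, x ≠ r → G.Adj r x := by
      intro x hx
      rw [← dist_eq_one_iff_adj]
      have h0 := hG.pos_dist_of_ne hx.symm
      have h2 := hx₀ x
      have h3 := hcon (G.dist r x₀ - 2)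
      omega
    refine hne (eq_top_iff.2 fun a b (hab : a ≠ b) => ?_)
    by_cases ha : a = r
    · exact ha ▸ h1 b fun h => hab (ha.trans h.symm)
    · by_cases hb : b = r
      · exact hb ▸ (h1 a ha).symm
      · have hdom : ∀ z, z = r ∨ G.Adj r z := fun z => or_iff_not_imp_left.2 (h1 z)
        exact hW.adj_of_dominated (h1 a ha) (h1 b hb) hab (fun z _ => hdom z) fun z _ => hdom z
  obtain ⟨w₀, hxw₀, hw₀⟩ := hG.exists_adj_dist_eq hk
  obtain ⟨v, hw₀v, hv⟩ := hG.exists_adj_dist_eq hw₀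
  set d := G.dist r with hd
  have hd1 : ∀ {x y}, G.Adj x y → d y ≤ d x + 1 := hG.dist_le_dist_add_one
  have hmax : ∀ x, d x ≤ k + 2 := fun x => hk ▸ hx₀ x
  let C : Set V := {w | d w = k + 1 ∧ (w = w₀ ∨ G.Adj w₀ w)}
  let L : V → Set V := fun w => {x | d x = k + 2 ∧ G.Adj w x}
  have hw₀C : w₀ ∈ C := ⟨hw₀, Or.inl rfl⟩
  have hCv : ∀ w ∈ C, G.Adj w v := by
    rintro w ⟨hw, rfl | h⟩
    · exact hw₀v
    · exact hB.adj_of_adj_parent hG hw₀ hw h hw₀v hv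
  have hCC : ∀ w ∈ C, ∀ z, d z = k + 1 → G.Adj w z → z ∈ C := by
    rintro w ⟨hw, rfl | h⟩ z hz hwz
    · exact ⟨hz, Or.inr hwz⟩
    · refine ⟨hz, or_iff_not_imp_left.2 fun hne => ?_⟩
      exact hB.adj_trans_of_dist_eq hG (hw₀.trans hw.symm) (hz.trans hw.symm) h hwz (Ne.symm hne)
  have hCcl : ∀ a ∈ C, ∀ b ∈ C, a ≠ b → G.Adj a b := by
    rintro a ⟨ha, rfl | ha'⟩ b ⟨hb, rfl | hb'⟩ hab
    · exact absurd rfl hab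
    · exact hb'
    · exact ha'.symm
    · exact hB.adj_trans_of_dist_eq hG (ha.trans hw₀.symm) (hb.trans hw₀.symm) ha'.symm hb' hab
  have hnL : ∀ w ∈ C, ∀ x ∈ L w, ∀ y, G.Adj x y → y = w ∨ y ∈ L w := by
    rintro w hw x ⟨hx, hwx⟩ y hxy
    have h1 := hd1 hxy.symm
    have h2 := hmax y
    rcases (show d y = k + 1 ∨ d y = k + 2 by omega) with hy | hy
    · exact Or.inl (hB.parent_unique hG hx hy hw.1 hxy hwx.symm)
    · exact Or.inr ⟨hy, (hB.adj_of_adj_parent hG hx hy hxy hwx.symm hw.1).symm⟩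
  have hnC : ∀ w ∈ C, ∀ y, G.Adj w y → y = v ∨ y ∈ C ∨ y ∈ L w := by
    intro w hw y hwy
    have h1 := hd1 hwy.symm
    have h2 := hmax y
    have h3 := hw.1
    rcases (show d y = k ∨ d y = k + 1 ∨ d y = k + 2 by omega) with hy | hy | hy
    · exact Or.inl (hB.parent_unique hG hw.1 hy hv hwy (hCv w hw))
    · exact Or.inr (Or.inl (hCC w hw y hy hwy))
    · exact Or.inr (Or.inr ⟨hy, hwy⟩)
  have hdomL : ∀ w ∈ C, ∀ x ∈ L w, ∀ z, G.Adj x z → z = w ∨ G.Adj w z := fun w hw x hx z hxz =>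
    (hnL w hw x hx z hxz).imp_right And.right
  have hLcl : ∀ w ∈ C, ∀ x ∈ L w, ∀ y ∈ L w, x ≠ y → G.Adj x y := fun w hw x hx y hy hxy =>
    hW.adj_of_dominated hx.2 hy.2 hxy (hdomL w hw x hx) (hdomL w hw y hy)
  have hx₀L : x₀ ∈ L w₀ := ⟨hk, hxw₀.symm⟩
  have hLne : ∀ w ∈ C, (L w).Nonempty := by
    intro w hw
    by_contra hem
    have hwL : ∀ x, x ∉ L w := fun x hx => hem ⟨x, hx⟩
    have hww₀ : w ≠ w₀ := fun h => hwL x₀ (h ▸ hx₀L)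
    -- A childless `w` has all its neighbours in `C` or equal to `v`, so `w₀` dominates them; the
    -- exchange makes `x₀` a child of `w`.
    refine hwL x₀ ⟨hk, (hW.adj_of_dominated (w := w₀) hxw₀.symm (hCcl _ hw₀C _ hw hww₀.symm) ?_
      (hdomL _ hw₀C _ hx₀L) fun z hz => ?_).symm⟩
    · rintro rfl
      have := hw.1
      omega
    · rcases hnC w hw z hz with rfl | h | h
      · exact Or.inr hw₀v
      · exact h.2
      · exact absurd h (hwL z)
  have hvC : v ∉ C := fun h => by have := h.1; omega
  have hvL : ∀ w ∈ C, v ∉ L w := fun w _ h => by have := h.1; omega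
  have hCv' : G.IsClique (insert v C) :=
    isClique_insert.2 ⟨fun a ha b hb => hCcl a ha b hb, fun w hw _ => (hCv w hw).symm⟩
  have hLw : ∀ w ∈ C, G.IsClique (insert w (L w)) := fun w hw =>
    isClique_insert.2 ⟨fun a ha b hb => hLcl w hw a ha b hb, fun x hx _ => hx.2⟩
  have hLC : ∀ w ∈ C, ∀ w' ∈ C, w ∉ L w' := fun w hw w' _ h => by
    have h1 := hw.1
    have h2 := h.1
    omega
  obtain ⟨q, hq, hiso⟩ := exists_iso_attachClique hvC hvL hCv' hLw hLC
    (fun w hw w' hw' hne => Set.disjoint_left.2 fun x hx hx' =>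
      hne (hB.parent_unique hG hx.1 hw.1 hw'.1 hx.2.symm hx'.2.symm)) hnL hnC
  refine ⟨_, _, _, q, ?_, ?_, ?_, ?_, hiso⟩
  · rw [← not_subsingleton_iff_nontrivial]
    intro hsub
    have hR : ∀ z, (∀ w ∈ C, z ∉ insert w (L w)) → z = v := fun z hz =>
      congrArg Subtype.val (Subsingleton.elim (α := {x | ∀ w ∈ C, x ∉ insert w (L w)}) ⟨z, hz⟩
        ⟨v, fun w hw h => h.elim (fun h => hvC (h ▸ hw)) (hvL w hw)⟩)
    -- If only `v` were left, its neighbours would all lie in `C` and be dominated by `w₀`, forcing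
    -- an edge across two layers.
    have hadj : G.Adj x₀ v := by
      refine hW.adj_of_dominated hxw₀.symm hw₀v ?_ (hdomL _ hw₀C _ hx₀L) fun z hz => ?_
      · rintro rfl
        omega
      · by_cases h : ∀ w ∈ C, z ∉ insert w (L w)
        · exact absurd (hR z h) hz.ne'
        · push Not at h
          obtain ⟨w, hw, rfl | h⟩ := h
          · exact hw.2
          · have h1 := hd1 hz
            have h2 := h.1
            omega
    have h1 := hd1 hadj.symm
    omega
  · have : 0 < C.ncard := (Set.ncard_pos).2 ⟨w₀, hw₀C⟩
    omega
  · rw [← Set.ncard_insert_of_notMem hvC]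
    exact hCv'.ncard_le_cliqueNum
  · intro i
    obtain ⟨w, hw, hqi⟩ := hq i
    have : 0 < (L w).ncard := (Set.ncard_pos).2 (hLne w hw)
    refine ⟨by omega, ?_⟩
    rw [hqi, ← Set.ncard_insert_of_notMem (hLC w hw w hw)]
    exact (hLw w hw).ncard_le_cliqueNum

end Decompose

/-! ### Properties preserved and reflected by attaching cliques -/

section AttachClique

variable {V : Type u} {H : SimpleGraph V} {v : V} {s : ℕ} {q : Fin (s - 1) → ℕ}

theorem attachClique_adj_inl_inr {a : V} {y : Σ i : Fin (s - 1), Fin (q i)} :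
    (H.attachClique v s q).Adj (.inl a) (.inr y) ↔ a = v ∧ y.2.val = 0 := Iff.rfl

theorem attachClique_adj_inr_inl {x : Σ i : Fin (s - 1), Fin (q i)} {b : V} :
    (H.attachClique v s q).Adj (.inr x) (.inl b) ↔ b = v ∧ x.2.val = 0 := Iff.rfl

theorem attachClique_adj_inr_inr {x y : Σ i : Fin (s - 1), Fin (q i)} :
    (H.attachClique v s q).Adj (.inr x) (.inr y) ↔
      (x.1 = y.1 ∧ x.2.val ≠ y.2.val) ∨ (x.1 ≠ y.1 ∧ x.2.val = 0 ∧ y.2.val = 0) := Iff.rfl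

/-- The base graph embeds into the extended graph. -/
def attachCliqueInl (H : SimpleGraph V) (v : V) (s : ℕ) (q : Fin (s - 1) → ℕ) :
    H ↪g H.attachClique v s q where
  toFun := Sum.inl
  inj' := Sum.inl_injective
  map_rel_iff' := Iff.rfl

theorem Connected.of_attachClique (h : (H.attachClique v s q).Connected) : H.Connected := by
  -- Collapsing all new vertices to `v` sends each edge to an edge or a point.
  let ret : V ⊕ (Σ i : Fin (s - 1), Fin (q i)) → V := Sum.elim id fun _ => v
  have step : ∀ x y, (H.attachClique v s q).Adj x y → H.Reachable (ret x) (ret y) := by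
    rintro (a | x) (b | y) hxy
    · exact Adj.reachable hxy
    · rw [show ret (.inl a) = v from hxy.1]
      exact Reachable.refl _
    · rw [show ret (.inl b) = v from hxy.1]
      exact Reachable.refl _
    · exact Reachable.refl _
  have walk : ∀ x y, (H.attachClique v s q).Walk x y → H.Reachable (ret x) (ret y) := by
    intro x y p
    induction p with
    | nil => exact Reachable.refl _
    | cons hadj _ ih => exact (step _ _ hadj).trans ih
  refine (connected_iff _).2 ⟨fun a b => ?_, ⟨v⟩⟩
  obtain ⟨p⟩ := h.preconnected (.inl a) (.inl b)
  exact walk _ _ p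

theorem Connected.attachClique (h : H.Connected) : (H.attachClique v s q).Connected := by
  refine connected_iff_exists_forall_reachable _ |>.2 ⟨.inl v, ?_⟩
  rintro (b | ⟨i, j⟩)
  · exact (h.preconnected v b).map (attachCliqueInl H v s q).toHom
  · have h0 : (H.attachClique v s q).Reachable (.inl v) (.inr ⟨i, ⟨0, j.pos⟩⟩) :=
      Adj.reachable (attachClique_adj_inl_inr.2 ⟨rfl, rfl⟩)
    by_cases hj : j.val = 0
    · rwa [show j = ⟨0, j.pos⟩ from Fin.ext hj]
    · exact h0.trans (Adj.reachable (attachClique_adj_inr_inr.2 (Or.inl ⟨rfl, Ne.symm hj⟩)))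

/-- A nonseparable set cannot straddle a cut vertex. Cutting at the attaching vertices and at `v`
confines it to one pendant clique, to `Q`, or to `H`. -/
theorem IsBlockGraph.attachClique [Finite V] (h : H.IsBlockGraph) :
    (H.attachClique v s q).IsBlockGraph := by
  rw [isBlockGraph_iff] at h ⊢
  intro S hS
  by_cases hpend : ∃ i, ∃ j : Fin (q i), j.val ≠ 0 ∧ Sum.inr ⟨i, j⟩ ∈ S
  · obtain ⟨i, j, hj, hjS⟩ := hpend
    have hsub := hS.subset_or_disjoint (c := .inr ⟨i, ⟨0, j.pos⟩⟩)
      (A := {x | ∃ j : Fin (q i), j.val ≠ 0 ∧ x = .inr ⟨i, j⟩}) ?_ ?_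
    · have hsub := hsub.resolve_right fun hd => Set.disjoint_left.1 hd hjS ⟨j, hj, rfl⟩
      have hQ : ∀ x ∈ S, ∃ j : Fin (q i), x = .inr ⟨i, j⟩ := fun x hx =>
        (hsub hx).elim (fun h => ⟨_, h⟩) fun ⟨j, _, h⟩ => ⟨j, h⟩
      intro x hx y hy hxy
      obtain ⟨a, rfl⟩ := hQ x hx
      obtain ⟨b, rfl⟩ := hQ y hy
      exact attachClique_adj_inr_inr.2 (Or.inl ⟨rfl, fun hab =>
        hxy (congrArg (Sum.inr ∘ Sigma.mk i) (Fin.ext hab))⟩)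
    · rintro ⟨a, ha, hx⟩
      rw [Sum.inr.injEq, Sigma.mk.injEq, heq_eq_eq] at hx
      exact ha (hx.2 ▸ rfl)
    · rintro _ ⟨a, ha, rfl⟩ (b | ⟨i', b⟩) hadj
      · exact absurd (attachClique_adj_inr_inl.1 hadj).2 ha
      · rcases attachClique_adj_inr_inr.1 hadj with ⟨h1, h2⟩ | ⟨_, h2, _⟩
        · obtain rfl : i = i' := h1
          by_cases hb : b.val = 0
          · exact Or.inr (by rw [show b = ⟨0, j.pos⟩ from Fin.ext hb])
          · exact Or.inl ⟨b, hb, rfl⟩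
        · exact absurd h2 ha
  · push Not at hpend
    have hz : ∀ i, ∀ j : Fin (q i), Sum.inr ⟨i, j⟩ ∈ S → j.val = 0 := fun i j hj => by
      by_contra h0
      exact hpend i j h0 hj
    have hsub := hS.subset_or_disjoint (c := .inl v) (A := Set.range Sum.inr) (by simp) ?_
    · rcases hsub with hsub | hdis
      · rintro x hx y hy hxy
        rcases hsub hx with rfl | ⟨⟨i, a⟩, rfl⟩ <;> rcases hsub hy with rfl | ⟨⟨i', b⟩, rfl⟩
        · exact absurd rfl hxy
        · exact attachClique_adj_inl_inr.2 ⟨rfl, hz _ _ hy⟩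
        · exact attachClique_adj_inr_inl.2 ⟨rfl, hz _ _ hx⟩
        · refine attachClique_adj_inr_inr.2 (Or.inr ⟨?_, hz _ _ hx, hz _ _ hy⟩)
          rintro (rfl : i = i')
          exact hxy (by rw [Fin.ext ((hz _ _ hx).trans (hz _ _ hy).symm)])
      · have hS' : S = attachCliqueInl H v s q '' (Sum.inl ⁻¹' S) := by
          ext (x | x)
          · exact ⟨fun hx => ⟨x, hx, rfl⟩, fun ⟨y, hy, hyx⟩ => Sum.inl_injective hyx ▸ hy⟩
          · exact ⟨fun hx => absurd ⟨x, rfl⟩ (Set.disjoint_left.1 hdis hx),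
              fun ⟨y, _, hyx⟩ => absurd hyx Sum.inl_ne_inr⟩
        rw [hS', isNonseparable_image_iff] at hS
        rw [hS']
        rintro _ ⟨a, ha, rfl⟩ _ ⟨b, hb, rfl⟩ hab
        exact h _ hS ha hb fun h => hab (h ▸ rfl)
    · rintro _ ⟨x, rfl⟩ (b | y) hadj
      · exact Or.inr (by rw [(attachClique_adj_inr_inl.1 hadj).1])
      · exact Or.inl ⟨y, rfl⟩

theorem IsIndepSet.card_le_card_toLeft_add
    {I : Finset (V ⊕ (Σ i : Fin (s - 1), Fin (q i)))}
    (hI : (H.attachClique v s q).IsIndepSet I) : I.card ≤ I.toLeft.card + (s - 1) := by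
  rw [← Finset.card_toLeft_add_card_toRight]
  refine Nat.add_le_add_left ?_ _
  calc I.toRight.card ≤ (Finset.univ : Finset (Fin (s - 1))).card := by
        refine Finset.card_le_card_of_injOn Sigma.fst (fun _ _ => Finset.mem_univ _) ?_
        rintro ⟨i, a⟩ ha ⟨i', b⟩ hb (rfl : i = i')
        by_contra hne
        refine hI (Finset.mem_toRight.1 ha) (Finset.mem_toRight.1 hb)
          (Sum.inr_injective.ne hne) (attachClique_adj_inr_inr.2 (Or.inl ⟨rfl, fun hab => ?_⟩))
        exact hne (congrArg (Sigma.mk i) (Fin.ext hab))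
    _ = s - 1 := Finset.card_fin _

/-- Adjoin one vertex of each pendant clique to a set of vertices of the base graph. -/
def adjoinTransversal (J : Finset V) (f : ∀ i, Fin (q i)) :
    Finset (V ⊕ (Σ i : Fin (s - 1), Fin (q i))) :=
  J.disjSum (Finset.univ.map ⟨fun i => ⟨i, f i⟩, fun _ _ h => congrArg Sigma.fst h⟩)

theorem card_adjoinTransversal (J : Finset V) (f : ∀ i, Fin (q i)) :
    (adjoinTransversal J f).card = J.card + (s - 1) := by
  simp [adjoinTransversal]

theorem inl_mem_adjoinTransversal {J : Finset V} {f : ∀ i, Fin (q i)} {a : V} :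
    Sum.inl a ∈ adjoinTransversal J f ↔ a ∈ J := by
  simp [adjoinTransversal]

theorem inr_mem_adjoinTransversal {J : Finset V} {f : ∀ i, Fin (q i)} {i : Fin (s - 1)}
    {j : Fin (q i)} : Sum.inr ⟨i, j⟩ ∈ adjoinTransversal J f ↔ f i = j := by
  simp only [adjoinTransversal, Finset.inr_mem_disjSum, Finset.mem_map, Finset.mem_univ, true_and]
  constructor
  · rintro ⟨i', h⟩
    cases h
    rfl
  · rintro rfl
    exact ⟨i, rfl⟩

/-- Different pendant cliques, and `H`, meet only along edges of `Q`, so it suffices that the set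
has at most one vertex in `Q`. -/
theorem IsIndepSet.adjoinTransversal {J : Finset V} (hJ : H.IsIndepSet J) {f : ∀ i, Fin (q i)}
    (hf : ∀ i i', (f i).val = 0 → (f i').val = 0 → i = i')
    (hv : ∀ i, (f i).val = 0 → v ∉ J) :
    (H.attachClique v s q).IsIndepSet (adjoinTransversal J f : Finset _) := by
  rintro (a | ⟨i, a⟩) ha (b | ⟨i', b⟩) hb hab h <;>
    simp only [Finset.mem_coe, inl_mem_adjoinTransversal, inr_mem_adjoinTransversal] at ha hb
  · exact hJ ha hb (fun h => hab (h ▸ rfl)) h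
  · subst hb
    obtain ⟨rfl, h0⟩ := attachClique_adj_inl_inr.1 h
    exact hv _ h0 ha
  · subst ha
    obtain ⟨rfl, h0⟩ := attachClique_adj_inr_inl.1 h
    exact hv _ h0 hb
  · subst ha hb
    rcases attachClique_adj_inr_inr.1 h with ⟨h1, h2⟩ | ⟨h1, h2, h3⟩
    · obtain rfl : i = i' := h1
      exact h2 rfl
    · exact h1 (hf _ _ h2 h3)

theorem IsIndepSet.toLeft {I : Finset (V ⊕ (Σ i : Fin (s - 1), Fin (q i)))}
    (hI : (H.attachClique v s q).IsIndepSet I) : H.IsIndepSet I.toLeft :=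
  fun _ ha _ hb hab h => hI (Finset.mem_toLeft.1 ha) (Finset.mem_toLeft.1 hb)
    (Sum.inl_injective.ne hab) h

theorem IsMaximumIndepSet.adjoinTransversal [Finite V] {J : Finset V}
    (hJ : H.IsMaximumIndepSet J) {f : ∀ i, Fin (q i)}
    (hf : ∀ i i', (f i).val = 0 → (f i').val = 0 → i = i')
    (hv : ∀ i, (f i).val = 0 → v ∉ J) :
    (H.attachClique v s q).IsMaximumIndepSet (SimpleGraph.adjoinTransversal J f) where
  isIndepSet := hJ.isIndepSet.adjoinTransversal hf hv
  maximum t ht := by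
    rw [card_adjoinTransversal]
    exact ht.card_le_card_toLeft_add.trans (Nat.add_le_add_right (hJ.maximum _ ht.toLeft) _)

theorem IsWellCovered.of_attachClique [Finite V] (hq : ∀ i, 2 ≤ q i)
    (h : (H.attachClique v s q).IsWellCovered) : H.IsWellCovered := by
  intro w
  obtain ⟨I, hI, hw⟩ := h (.inl w)
  refine ⟨I.toLeft, ⟨hI.isIndepSet.toLeft, fun J hJ => ?_⟩, Finset.mem_toLeft.2 hw⟩
  -- Index `1` exists since `2 ≤ q i`, and avoids `Q`.
  have h1 := hI.maximum _ (hJ.adjoinTransversal (v := v) (f := fun i => ⟨1, hq i⟩)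
    (fun _ _ h => absurd h one_ne_zero) fun _ h => absurd h one_ne_zero)
  have h2 := hI.isIndepSet.card_le_card_toLeft_add
  rw [card_adjoinTransversal] at h1
  omega

theorem IsWellCovered.attachClique [Finite V] [Nontrivial V] (hq : ∀ i, 2 ≤ q i)
    (hc : H.Connected) (h : H.IsWellCovered) : (H.attachClique v s q).IsWellCovered := by
  classical
  -- A maximum independent set through a neighbour of `v` misses `v`, leaving room for one new
  -- vertex of `Q`.
  obtain ⟨u, hu⟩ := hc.preconnected.exists_adj_of_nontrivial v
  obtain ⟨J₀, hJ₀, huJ⟩ := h u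
  have hvJ : v ∉ J₀ := fun hv => hJ₀.isIndepSet hv huJ hu.ne hu
  rintro (w | ⟨i, j⟩)
  · obtain ⟨J, hJ, hw⟩ := h w
    exact ⟨_, hJ.adjoinTransversal (f := fun i => ⟨1, hq i⟩)
      (fun _ _ h => absurd h one_ne_zero) fun _ h => absurd h one_ne_zero,
      inl_mem_adjoinTransversal.2 hw⟩
  · have hf : ∀ i', (Function.update (fun i => (⟨1, hq i⟩ : Fin (q i))) i j i').val = 0 →
        i' = i := by
      intro i' h0
      by_contra hne
      rw [Function.update_of_ne hne] at h0
      exact one_ne_zero h0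
    exact ⟨_, hJ₀.adjoinTransversal (fun a b ha hb => (hf a ha).trans (hf b hb).symm)
      fun _ _ => hvJ, inr_mem_adjoinTransversal.2 (Function.update_self _ _ _)⟩

theorem IsWellCovered.of_iso {W : Type*} [Finite V] [Finite W] {G : SimpleGraph W}
    (e : G ≃g H) (h : H.IsWellCovered) : G.IsWellCovered := by
  intro w
  obtain ⟨I, hI, hw⟩ := h (e w)
  refine ⟨I.map e.symm.toEquiv.toEmbedding, ⟨?_, fun t ht => ?_⟩, ?_⟩
  · intro a ha b hb hab hadj
    simp only [Finset.coe_map, Set.mem_image, Finset.mem_coe] at ha hb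
    obtain ⟨a, ha, rfl⟩ := ha
    obtain ⟨b, hb, rfl⟩ := hb
    exact hI.isIndepSet ha hb (fun h => hab (h ▸ rfl)) (e.symm.map_adj_iff.1 hadj)
  · rw [Finset.card_map, ← Finset.card_map e.toEquiv.toEmbedding]
    refine hI.maximum _ ?_
    intro a ha b hb hab hadj
    simp only [Finset.coe_map, Set.mem_image, Finset.mem_coe] at ha hb
    obtain ⟨a, ha, rfl⟩ := ha
    obtain ⟨b, hb, rfl⟩ := hb
    exact ht ha hb (fun h => hab (h ▸ rfl)) (e.map_adj_iff.1 hadj)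
  · exact Finset.mem_map.2 ⟨e w, hw, e.symm_apply_apply w⟩

theorem isWellCovered_top [Finite V] : (⊤ : SimpleGraph V).IsWellCovered := by
  refine fun v => ⟨{v}, ⟨by simp, fun t ht => ?_⟩, Finset.mem_singleton_self v⟩
  rw [Finset.card_singleton, Finset.card_le_one]
  intro a ha b hb
  by_contra hab
  exact ht ha hb hab hab

theorem isBlockGraph_top : (⊤ : SimpleGraph V).IsBlockGraph :=
  fun _ _ _ _ _ _ hab => hab

end AttachClique

end SimpleGraph

theorem mainTheorem2 {V : Type u} [Finite V] [Nonempty V] (G : SimpleGraph V) :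
    (G.Connected ∧ G.IsBlockGraph ∧ G.IsWellCovered) ↔
      ((G = ⊤ ∧ Nat.card V ≤ G.cliqueNum) ∨
        ∃ (W : Type u) (_ : Finite W) (_ : Nontrivial W) (H : SimpleGraph W) (v : W)
          (s : ℕ) (q : Fin (s - 1) → ℕ),
          (H.Connected ∧ H.IsBlockGraph ∧ H.IsWellCovered) ∧
          Nat.card W < Nat.card V ∧
          H.cliqueNum ≤ G.cliqueNum ∧
          (2 ≤ s ∧ s ≤ G.cliqueNum) ∧
          (∀ i, 2 ≤ q i ∧ q i ≤ G.cliqueNum) ∧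
          Nonempty (G ≃g H.attachClique v s q)) := by
  constructor
  · rintro ⟨hG, hB, hW⟩
    by_cases htop : G = ⊤
    · refine Or.inl ⟨htop, ?_⟩
      rw [← Set.ncard_univ]
      exact SimpleGraph.IsClique.ncard_le_cliqueNum fun a _ b _ hab => htop ▸ hab
    · obtain ⟨R, v, s, q, hR, hs, hs', hq, ⟨e⟩⟩ :=
        SimpleGraph.exists_attachClique_of_ne_top hG hB hW htop
      refine Or.inr ⟨R, inferInstance, hR, G.induce R, v, s, q,
        ⟨(e.connected_iff.1 hG).of_attachClique, hB.of_embedding (SimpleGraph.Embedding.induce R),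
          (hW.of_iso e.symm).of_attachClique fun i => (hq i).1⟩,
        ?_, SimpleGraph.cliqueNum_induce_le R, ⟨hs, hs'⟩, hq, ⟨e⟩⟩
      have : Nonempty (Σ i : Fin (s - 1), Fin (q i)) :=
        ⟨⟨0, by omega⟩, ⟨0, by have := (hq ⟨0, by omega⟩).1; omega⟩⟩
      rw [Nat.card_congr e.toEquiv, Nat.card_sum]
      exact Nat.lt_add_of_pos_right Nat.card_pos
  · rintro (⟨rfl, -⟩ | ⟨W, _, _, H, v, s, q, ⟨hc, hB, hW⟩, -, -, -, hq, ⟨e⟩⟩)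
    · exact ⟨SimpleGraph.connected_top, SimpleGraph.isBlockGraph_top,
        SimpleGraph.isWellCovered_top⟩
    · exact ⟨e.connected_iff.2 hc.attachClique, hB.attachClique.of_embedding e.toEmbedding,
        (hW.attachClique (fun i => (hq i).1) hc).of_iso e⟩
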